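/- Let $n\in\mathbb N$, $\mathbb U^n=(0,1)^n$, and let $\hat f$ be a vector field on the closed cube $[0,1]^n$ with values in $\mathbb R^n$ such that $\hat f_i(\mathbf u)=0$ whenever $u_i=0$ or $u_i=1$, and such that $\hat f$ has an analytic continuation $\hat g$ that is holomorphic on the complex polydisk $\{\mathbf w\in\mathbb C^n : |w_i-\tfrac12|<r\ \text{for all } i\}$ for some $r>1$. Let $\hat\phi(\mathbf u,s)$ denote the flow of $\dot{\mathbf u}=\hat f(\mathbf u)$ on $\mathbb U^n$, let $R\subseteq\mathbb U^n$ be a hyperrectangle, and for $\tau>0$ put $$\Omega(s)=\{\mathbf u\in\mathbb U^n : \hat\phi(\mathbf u,\tau-s)\in R\},\qquad V_\Omega(s;\tau)=\mathrm{vol}(\Omega(s)).$$ For $k\ge 0$ let $\tilde V_\Omega(s;\tau)=\sum_{j=0}^{k}\frac{d^jV_\Omega}{ds^j}\Big|_{s=\tau}\frac{(s-\tau)^j}{j!}$ be the degree-$k$ Taylor polynomial of $V_\Omega(\cdot;\tau)$ about $\tau$, and define $\Gamma_0=1$, $\Gamma_{j}=\nabla\cdot(\Gamma_{j-1}\hat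 f)$. Let $0\le t<\tau$, let $\mathcal R[t,\tau]$ be a set containing $\Omega(s)$ for every $s\in[t,\tau]$, and let $$\delta_k\ \ge\ \sup_{\mathbf u\in\mathcal R[t,\tau]}(-1)^{k+1}\Gamma_{k+1}(\mathbf u).$$ Let $\kappa\ge\tilde V_\Omega(\xi;\tau)$ for all $\xi\in[t,\tau]$. Then, if $0\le\delta_k<\frac{(k+1)!}{|t-\tau|^{k+1}}$, $$\sup_{\xi\in[t,\tau]}V_\Omega(\xi;\tau)\ \le\ \kappa\Big(1-\delta_k\frac{|t-\tau|^{k+1}}{(k+1)!}\Big)^{-1},$$ and moreover $$V_\Omega(t;\tau)\ \le\ \tilde V_\Omega(t;\tau)+\kappa\,\delta_k\Big(\frac{(k+1)!}{|t-\tau|^{k+1}}-\delta_k\Big)^{-1}.$$ -/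

import Mathlib

open MeasureTheory Set

/-- The open unit hyperrectangle `(0, 1)ⁿ`. -/
def unitCube (n : ℕ) : Set (Fin n → ℝ) := {u | ∀ i, 0 < u i ∧ u i < 1}

/-- A hyperrectangle: a product of intervals (of any kind, possibly degenerate). -/
def IsHyperrectangle {n : ℕ} (R : Set (Fin n → ℝ)) : Prop :=
  ∃ I : Fin n → Set ℝ, (∀ i, (I i).OrdConnected) ∧ R = {u | ∀ i, u i ∈ I i}

/-- The boundary conditions: on the closed cube, the `i`-th component of the field vanishes
wherever `u i = 0` or `u i = 1`. -/
def SatisfiesBoundaryConditions {n : ℕ} (f : (Fin n → ℝ) → (Fin n → ℝ)) : Prop :=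
  ∀ u : Fin n → ℝ, (∀ i, 0 ≤ u i ∧ u i ≤ 1) → ∀ i, (u i = 0 ∨ u i = 1) → f u i = 0

/-- The open complex polydisk of polyradius `r` centred at `w₀`. -/
def polydisk {n : ℕ} (r : ℝ) (w₀ : Fin n → ℂ) : Set (Fin n → ℂ) := {w | ∀ i, ‖w i - w₀ i‖ < r}

/-- The field on the closed unit cube has an analytic continuation that is holomorphic on a
polydisk of radius `r > 1` centred at `(1/2, …, 1/2)`. -/
def HasHolomorphicContinuation {n : ℕ} (f : (Fin n → ℝ) → (Fin n → ℝ)) : Prop :=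
  ∃ r : ℝ, 1 < r ∧ ∃ g : (Fin n → ℂ) → (Fin n → ℂ),
    DifferentiableOn ℂ g (polydisk r (fun _ => 1 / 2)) ∧
    ∀ u : Fin n → ℝ, (∀ i, 0 ≤ u i ∧ u i ≤ 1) →
      g (fun i => (u i : ℂ)) = fun i => (f u i : ℂ)

/-- `x` is a trajectory of `u' = f u` in the open unit cube, defined for all times. -/
def IsTrajectory {n : ℕ} (f : (Fin n → ℝ) → (Fin n → ℝ)) (x : ℝ → (Fin n → ℝ)) : Prop :=
  ∀ s : ℝ, x s ∈ unitCube n ∧ HasDerivAt x (f (x s)) s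

open Classical in
/-- The flow of `u' = f u` on the open unit cube: `flow f u s` is the state at time `s` of the
trajectory that is at `u` at time `0` (and `u` if there is no such trajectory). -/
noncomputable def flow {n : ℕ} (f : (Fin n → ℝ) → (Fin n → ℝ)) (u : Fin n → ℝ) (s : ℝ) :
    Fin n → ℝ :=
  if h : ∃ x : ℝ → (Fin n → ℝ), IsTrajectory f x ∧ x 0 = u then h.choose s else u

/-- The control mass at time `t`: the states in the unit cube which, if occupied at time `t`,
lead to `R` at time `τ`. -/
def controlMass {n : ℕ} (f : (Fin n → ℝ) → (Fin n → ℝ)) (R : Set (Fin n → ℝ)) (τ t : ℝ) :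
    Set (Fin n → ℝ) :=
  {u | u ∈ unitCube n ∧ flow f u (τ - t) ∈ R}

/-- The volume function `t ↦ V(t; τ)`: the Lebesgue measure of the control mass at time `t`. -/
noncomputable def volumeFunction {n : ℕ} (f : (Fin n → ℝ) → (Fin n → ℝ)) (R : Set (Fin n → ℝ))
    (τ t : ℝ) : ℝ :=
  (volume (controlMass f R τ t)).toReal

/-- The degree-`k` Taylor polynomial of `V(·; τ)` about `τ`, evaluated at `t`. -/
noncomputable def taylorVolume {n : ℕ} (f : (Fin n → ℝ) → (Fin n → ℝ)) (R : Set (Fin n → ℝ))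
    (k : ℕ) (τ t : ℝ) : ℝ :=
  ∑ j ∈ Finset.range (k + 1),
    iteratedDeriv j (volumeFunction f R τ) τ * ((t - τ) ^ j / (j.factorial : ℝ))

/-- The divergence of a vector field on `ℝⁿ`. -/
noncomputable def divergence {n : ℕ} (F : (Fin n → ℝ) → (Fin n → ℝ)) (u : Fin n → ℝ) : ℝ :=
  ∑ i, fderiv ℝ (fun v => F v i) u (Pi.single i 1)

/-- The functions `Γ_k`: `Γ_0 = 1` and `Γ_{k+1} = ∇ · (Γ_k f)`. -/
noncomputable def Gam {n : ℕ} (f : (Fin n → ℝ) → (Fin n → ℝ)) : ℕ → (Fin n → ℝ) → ℝ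
  | 0 => fun _ => 1
  | k + 1 => divergence (fun u => Gam f k u • f u)

/-! The bounds come from a Taylor expansion whose remainder is controlled by the function being
expanded. Going from time `s` to `s'`, the flow carries the control mass at `s` onto the control
mass at `s'`, so the Reynolds transport theorem says that the integral of a smooth `G` over the
control mass has as time derivative the integral of `∇ · (G f)`. Starting from `G = 1`, the `j`-th
derivative of the volume `V` is the integral of `Γ_j` (`iteratedDeriv_volumeFunction`). Hence
`(-1)^(k+1) V^(k+1) ≤ δ V` on `[t, τ]`. With `c = (τ - t)^(k+1) / (k+1)!` and `M = sup V`,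
Lagrange's remainder is at most `δ M c` throughout the interval, so `M ≤ κ + δ c M`. Since `δ c <
1`, the last term can be absorbed, which bounds `M`; inserting this bound into the remainder at `t`
gives the second estimate.

The analytic work lies in the transport theorem. Holomorphy gives smoothness through Cauchy
integrals, and a cut-off produces a compactly supported smooth field `F` equal to `f` on the closed
cube; only values on the cube matter. The faces of the cube are invariant, so trajectories from the
interior exist for all times and stay inside.

Smooth dependence on initial states is not needed. By Grönwall the flow is Lipschitz in the state,
hence differentiable almost everywhere by Rademacher, which suffices for the change of variables.
The difference between the flow and one Euler step has a Lipschitz constant of order `h²`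
(`norm_flow_sub_euler_le`), so wherever the Jacobian exists it is `1 + h DF + O(h²)` uniformly, and
its determinant is `1 + h ∇ · F + o(h)`. -/

/-! ### Holomorphic functions of several variables are smooth. -/

section Holomorphic

variable {E F : Type} [NormedAddCommGroup E] [NormedSpace ℂ E]
  [NormedAddCommGroup F] [NormedSpace ℂ F]

/-- Cauchy's formula for the directional derivatives of a holomorphic function. -/
theorem fderiv_apply_eq_circleIntegral [FiniteDimensional ℂ F] {g : E → F} {w v : E} {ρ : ℝ} (hρ : 0 < ρ)
    (hg : ∀ z, ‖z - w‖ ≤ ρ * ‖v‖ → DifferentiableAt ℂ g z) :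
    fderiv ℂ g w v =
      (2 * Real.pi * Complex.I : ℂ)⁻¹ • ∮ ζ in C(0, ρ), (1 / (ζ - 0) ^ 2) • g (w + ζ • v) := by
  have := FiniteDimensional.complete ℂ F
  have hline : ∀ ζ ∈ Metric.closedBall (0 : ℂ) ρ,
      HasDerivAt (fun ζ : ℂ => g (w + ζ • v)) (fderiv ℂ g (w + ζ • v) v) ζ := by
    intro ζ hζ
    have h1 : HasDerivAt (fun ζ : ℂ => w + ζ • v) v ζ := by
      simpa using ((hasDerivAt_id ζ).smul_const v).const_add w
    have h2 : DifferentiableAt ℂ g (w + ζ • v) := by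
      apply hg
      rw [add_sub_cancel_left, norm_smul]
      exact mul_le_mul_of_nonneg_right (by simpa using hζ) (norm_nonneg _)
    exact h2.hasFDerivAt.comp_hasDerivAt ζ h1
  have hd : DifferentiableOn ℂ (fun ζ : ℂ => g (w + ζ • v)) (Metric.closedBall 0 ρ) :=
    fun ζ hζ => (hline ζ hζ).differentiableAt.differentiableWithinAt
  have h0 := (hline 0 (by simp [hρ.le])).deriv
  simp only [zero_smul, add_zero] at h0
  rw [← h0, hd.diffContOnCl_ball subset_rfl |>.deriv_eq_smul_circleIntegral hρ,
    inv_smul_smul₀ Complex.two_pi_I_ne_zero]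

/-- This is the one-variable Cauchy estimate on the complex line through `w` in direction `v`. It
turns a local bound on `g` into a local bound on its derivative. -/
theorem norm_fderiv_apply_le {g : E → F} {w v : E} {ρ C : ℝ} (hρ : 0 < ρ)
    (hg : ∀ z, ‖z - w‖ ≤ ρ * ‖v‖ → DifferentiableAt ℂ g z)
    (hC : ∀ z, ‖z - w‖ ≤ ρ * ‖v‖ → ‖g z‖ ≤ C) :
    ‖fderiv ℂ g w v‖ ≤ C / ρ := by
  have hline : ∀ ζ ∈ Metric.closedBall (0 : ℂ) ρ,
      ‖w + ζ • v - w‖ ≤ ρ * ‖v‖ := by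
    intro ζ hζ
    rw [add_sub_cancel_left, norm_smul]
    exact mul_le_mul_of_nonneg_right (by simpa using hζ) (norm_nonneg _)
  have hder : ∀ ζ ∈ Metric.closedBall (0 : ℂ) ρ,
      HasDerivAt (fun ζ : ℂ => g (w + ζ • v)) (fderiv ℂ g (w + ζ • v) v) ζ := by
    intro ζ hζ
    have h1 : HasDerivAt (fun ζ : ℂ => w + ζ • v) v ζ := by
      simpa using ((hasDerivAt_id ζ).smul_const v).const_add w
    exact (hg _ (hline ζ hζ)).hasFDerivAt.comp_hasDerivAt ζ h1
  have hd : DifferentiableOn ℂ (fun ζ : ℂ => g (w + ζ • v)) (Metric.closedBall 0 ρ) :=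
    fun ζ hζ => (hder ζ hζ).differentiableAt.differentiableWithinAt
  have h0 := (hder 0 (by simp [hρ.le])).deriv
  simp only [zero_smul, add_zero] at h0
  rw [← h0]
  exact Complex.norm_deriv_le_of_forall_mem_sphere_norm_le hρ
    (hd.diffContOnCl_ball subset_rfl)
    (fun ζ hζ => hC _ (hline ζ (Metric.sphere_subset_closedBall hζ)))

/-- A holomorphic function of several variables is locally Lipschitz. -/
theorem exists_lipschitzOnWith_ball_of_differentiableOn {g : E → F} {U : Set E} (hU : IsOpen U)
    (hg : DifferentiableOn ℂ g U) {w : E} (hw : w ∈ U) :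
    ∃ ε > 0, ∃ K : NNReal, Metric.ball w ε ⊆ U ∧ LipschitzOnWith K g (Metric.ball w ε) := by
  obtain ⟨ε₁, hε₁, h₁⟩ := Metric.isOpen_iff.1 hU w hw
  obtain ⟨ε₂, hε₂, h₂⟩ := Metric.continuousAt_iff.1
    ((hg w hw).differentiableAt (hU.mem_nhds hw)).continuousAt 1 one_pos
  -- A third of the radius leaves room for a Cauchy disk of radius `ε` around every point of the
  -- `ε`-ball.
  set ε := min ε₁ ε₂ / 3 with hε
  have hε0 : 0 < ε := by positivity
  have hsub : ∀ z ∈ Metric.ball w ε, ∀ z', ‖z' - z‖ ≤ ε → z' ∈ Metric.ball w (min ε₁ ε₂) := by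
    intro z hz z' hz'
    rw [Metric.mem_ball, dist_eq_norm] at *
    calc ‖z' - w‖ ≤ ‖z' - z‖ + ‖z - w‖ := norm_sub_le_norm_sub_add_norm_sub _ _ _
      _ < ε + ε := by linarith
      _ < min ε₁ ε₂ := by linarith
  have hdiff : ∀ z ∈ Metric.ball w (min ε₁ ε₂), DifferentiableAt ℂ g z := fun z hz =>
    (hg z (h₁ (Metric.ball_subset_ball (min_le_left _ _) hz))).differentiableAt
      (hU.mem_nhds (h₁ (Metric.ball_subset_ball (min_le_left _ _) hz)))
  have hbd : ∀ z ∈ Metric.ball w (min ε₁ ε₂), ‖g z‖ ≤ ‖g w‖ + 1 := by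
    intro z hz
    have := h₂ (lt_of_lt_of_le hz (min_le_right _ _))
    rw [dist_eq_norm] at this
    linarith [norm_le_norm_add_norm_sub' (g z) (g w)]
  refine ⟨ε, hε0, ⟨(‖g w‖ + 1) / ε, by positivity⟩, ?_, ?_⟩
  · refine (Metric.ball_subset_ball ?_).trans h₁
    linarith [min_le_left ε₁ ε₂]
  · refine (convex_ball w ε).lipschitzOnWith_of_nnnorm_fderiv_le (𝕜 := ℂ)
      (fun z hz => hdiff z (hsub z hz z (by simpa using hε0.le))) (fun z hz => ?_)
    change ‖fderiv ℂ g z‖ ≤ (‖g w‖ + 1) / ε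
    refine ContinuousLinearMap.opNorm_le_bound _ (by positivity) fun v => ?_
    rcases eq_or_ne v 0 with rfl | hv
    · simp
    have hv' : 0 < ‖v‖ := norm_pos_iff.2 hv
    -- With `ρ = ε / ‖v‖` the disk has radius `ε` in `E`, whatever the length of `v`.
    have := norm_fderiv_apply_le (g := g) (w := z) (v := v) (ρ := ε / ‖v‖) (C := ‖g w‖ + 1)
      (by positivity)
      (fun z' hz' => hdiff z' (hsub z hz z' (by rwa [div_mul_cancel₀ _ hv'.ne'] at hz')))
      (fun z' hz' => hbd z' (hsub z hz z' (by rwa [div_mul_cancel₀ _ hv'.ne'] at hz')))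
    refine this.trans (le_of_eq ?_)
    field_simp

/-- The derivative of a holomorphic function of several variables is holomorphic. -/
theorem differentiableOn_fderiv_of_isOpen [FiniteDimensional ℂ E] [FiniteDimensional ℂ F]
    {g : E → F} {U : Set E} (hU : IsOpen U)
    (hg : DifferentiableOn ℂ g U) : DifferentiableOn ℂ (fderiv ℂ g) U := by
  have key : ∀ v : E, DifferentiableOn ℂ (fun w => fderiv ℂ g w v) U := by
    intro v w hw
    obtain ⟨ε, hε, K, hsub, hlip⟩ := exists_lipschitzOnWith_ball_of_differentiableOn hU hg hw
    -- The `+ 1` allows `v = 0`; the circles around points of the half ball stay in the ball where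
    -- `g` is Lipschitz. That Lipschitz constant dominates the difference quotients under the Cauchy
    -- integral.
    set ρ := ε / (3 * (‖v‖ + 1)) with hρ
    have hv := norm_nonneg v
    have hρ0 : 0 < ρ := by positivity
    have hρv : ρ * ‖v‖ < ε / 2 := by
      rw [hρ, div_mul_eq_mul_div, div_lt_div_iff₀ (by positivity) (by positivity)]
      nlinarith
    have hin : ∀ z ∈ Metric.ball w (ε / 2), ∀ z', ‖z' - z‖ ≤ ρ * ‖v‖ → z' ∈ Metric.ball w ε := by
      intro z hz z' hz'
      rw [Metric.mem_ball, dist_eq_norm] at *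
      linarith [norm_sub_le_norm_sub_add_norm_sub z' z w]
    have hdiff : ∀ z ∈ Metric.ball w ε, DifferentiableAt ℂ g z := fun z hz =>
      (hg z (hsub hz)).differentiableAt (hU.mem_nhds (hsub hz))
    have hcirc : ∀ z ∈ Metric.ball w (ε / 2), ∀ θ : ℝ,
        z + circleMap 0 ρ θ • v ∈ Metric.ball w ε := by
      intro z hz θ
      refine hin z hz _ ?_
      rw [add_sub_cancel_left, norm_smul, norm_circleMap_zero, abs_of_pos hρ0]
    have hcauchy : (fun z => fderiv ℂ g z v) =ᶠ[nhds w] fun z =>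
        (2 * Real.pi * Complex.I : ℂ)⁻¹ • ∮ ζ in C(0, ρ), (1 / (ζ - 0) ^ 2) • g (z + ζ • v) := by
      filter_upwards [Metric.ball_mem_nhds w (half_pos hε)] with z hz
      exact fderiv_apply_eq_circleIntegral hρ0 (fun z' hz' => hdiff z' (hin z hz z' hz'))
    refine (DifferentiableAt.congr_of_eventuallyEq ?_ hcauchy).differentiableWithinAt
    refine DifferentiableAt.const_smul ?_ _
    let k : ℝ → ℂ := fun θ => deriv (circleMap 0 ρ) θ * (1 / (circleMap 0 ρ θ - 0) ^ 2)
    have hk : Continuous k := by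
      have h1 : Continuous (deriv (circleMap 0 ρ)) := by
        rw [funext (deriv_circleMap 0 ρ)]
        fun_prop
      refine h1.mul (continuous_const.div (by fun_prop) fun θ => ?_)
      have : circleMap 0 ρ θ ≠ 0 := circleMap_ne_center hρ0.ne'
      simpa using this
    have hform : ∀ z, (∮ ζ in C(0, ρ), (1 / (ζ - 0) ^ 2) • g (z + ζ • v)) =
        ∫ θ in (0 : ℝ)..2 * Real.pi, k θ • g (z + circleMap 0 ρ θ • v) := by
      intro z
      simp only [circleIntegral, k, mul_smul]
    simp only [hform]
    have hgc : ∀ z ∈ Metric.ball w (ε / 2), Continuous fun θ : ℝ => g (z + circleMap 0 ρ θ • v) :=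
      fun z hz => hlip.continuousOn.comp_continuous (by fun_prop) (hcirc z hz)
    let _ : MeasurableSpace E := borel E
    have : BorelSpace E := ⟨rfl⟩
    have : ProperSpace E := FiniteDimensional.proper ℂ E
    have : ProperSpace (E →L[ℂ] F) := FiniteDimensional.proper ℂ _
    have : CompleteSpace F := FiniteDimensional.complete ℂ F
    let _ : MeasurableSpace (E →L[ℂ] F) := borel _
    have : BorelSpace (E →L[ℂ] F) := ⟨rfl⟩
    have := intervalIntegral.hasFDerivAt_integral_of_dominated_loc_of_lip (𝕜 := ℂ)
      (μ := volume) (a := 0) (b := 2 * Real.pi) (s := Metric.ball w (ε / 2))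
      (F := fun z θ => k θ • g (z + circleMap 0 ρ θ • v))
      (F' := fun θ => k θ • fderiv ℂ g (w + circleMap 0 ρ θ • v)) (x₀ := w)
      (bound := fun θ => ‖k θ‖ * K)
      (Metric.ball_mem_nhds w (half_pos hε)) ?_ ?_ ?_ ?_ ?_ ?_
    · exact this.2.differentiableAt
    · filter_upwards [Metric.ball_mem_nhds w (half_pos hε)] with z hz
      exact (hk.smul (hgc z hz)).aestronglyMeasurable
    · exact (hk.smul (hgc w (Metric.mem_ball_self (half_pos hε)))).intervalIntegrable _ _
    -- Continuity of `fderiv ℂ g` is not yet known here; measurability of the derivative holds for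
    -- any function.
    · refine (hk.aestronglyMeasurable).smul ?_
      have hc : Continuous fun θ : ℝ => w + circleMap 0 ρ θ • v := by fun_prop
      exact ((measurable_fderiv ℂ g).comp hc.measurable).aestronglyMeasurable
    · refine Filter.Eventually.of_forall fun θ _ => ?_
      refine LipschitzOnWith.of_dist_le_mul fun z hz z' hz' => ?_
      rw [dist_eq_norm, ← smul_sub, norm_smul]
      have h1 := hlip.dist_le_mul _ (hcirc z hz θ) _ (hcirc z' hz' θ)
      rw [dist_eq_norm, dist_add_right] at h1
      have : ((Real.nnabs (‖k θ‖ * K) : NNReal) : ℝ) = ‖k θ‖ * K := by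
        rw [Real.coe_nnabs, abs_of_nonneg (by positivity)]
      rw [this, mul_assoc]
      exact mul_le_mul_of_nonneg_left h1 (norm_nonneg _)
    · exact (hk.norm.mul continuous_const).intervalIntegrable _ _
    · refine Filter.Eventually.of_forall fun θ _ => ?_
      have h1 := (hdiff _ (hcirc w (Metric.mem_ball_self (half_pos hε)) θ)).hasFDerivAt
      have h2 : HasFDerivAt (fun z => z + circleMap 0 ρ θ • v) (ContinuousLinearMap.id ℂ E) w :=
        (hasFDerivAt_id w).add_const _
      exact (h1.comp w h2).const_smul (k θ)
  -- A linear map is identified with its values on a basis, so differentiability of the derivative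
  -- reduces to that of each directional derivative.
  let e₁ := ContinuousLinearEquiv.ofFinrankEq
    (Module.finrank_fin_fun ℂ (n := Module.finrank ℂ E)).symm
  let e₂ := (e₁.arrowCongr (1 : F ≃L[ℂ] F)).trans (ContinuousLinearEquiv.piRing (Fin _))
  rw [← Function.id_comp (fderiv ℂ g), ← e₂.symm_comp_self]
  exact e₂.symm.differentiable.comp_differentiableOn (differentiableOn_pi.2 fun i => key _)

/-- A holomorphic function of several variables is smooth. -/
theorem contDiffOn_of_differentiableOn_complex [FiniteDimensional ℂ E] (m : ℕ) :
    ∀ {F : Type} [NormedAddCommGroup F]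
    [NormedSpace ℂ F] [FiniteDimensional ℂ F] {g : E → F} {U : Set E}, IsOpen U →
    DifferentiableOn ℂ g U → ContDiffOn ℂ m g U := by
  induction m with
  | zero => exact fun _ hg => contDiffOn_zero.2 hg.continuousOn
  | succ m ih =>
    intro F _ _ _ g U hU hg
    push_cast
    refine (contDiffOn_succ_iff_fderiv_of_isOpen hU).2 ⟨hg, by simp, ?_⟩
    exact ih hU (differentiableOn_fderiv_of_isOpen hU hg)

end Holomorphic

/-! ### Replacing the field by a smooth compactly supported one. -/

/-- A field with a holomorphic continuation agrees on the closed unit cube with a smooth field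
of compact support on the whole space. -/
theorem HasHolomorphicContinuation.exists_contDiff {n : ℕ} {f : (Fin n → ℝ) → (Fin n → ℝ)}
    (hf : HasHolomorphicContinuation f) :
    ∃ F : (Fin n → ℝ) → (Fin n → ℝ), ContDiff ℝ (⊤ : ℕ∞) F ∧ HasCompactSupport F ∧
      ∀ u : Fin n → ℝ, (∀ i, 0 ≤ u i ∧ u i ≤ 1) → F u = f u := by
  obtain ⟨r, hr, g, hg, hgf⟩ := hf
  have hopen : IsOpen (polydisk r (fun _ : Fin n => (1 / 2 : ℂ))) := by
    have : polydisk r (fun _ : Fin n => (1 / 2 : ℂ)) = ⋂ i, {w | ‖w i - 1 / 2‖ < r} := by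
      ext w; simp [polydisk]
    rw [this]
    exact isOpen_iInter_of_finite fun i => isOpen_lt (by fun_prop) continuous_const
  -- The bump is `1` on `[0, 1]` and vanishes at distance at least `1` from `1 / 2`. As `1 < r`, the
  -- support of the product cut-off stays inside the polydisk.
  let b : ContDiffBump (1 / 2 : ℝ) := ⟨1 / 2, 1, by norm_num, by norm_num⟩
  let χ : (Fin n → ℝ) → ℝ := fun u => ∏ i, b (u i)
  have hχ : ContDiff ℝ (⊤ : ℕ∞) χ :=
    contDiff_prod fun i _ => b.contDiff.comp (contDiff_apply ℝ ℝ i)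
  let F : (Fin n → ℝ) → (Fin n → ℝ) := fun u => χ u • fun i => (g (fun j => (u j : ℂ)) i).re
  have hsupp : Function.support F ⊆ Metric.closedBall (fun _ => 1 / 2) 1 := by
    intro u hu
    rw [mem_closedBall_iff_norm, pi_norm_le_iff_of_nonneg zero_le_one]
    intro i
    by_contra! h
    apply hu
    have : b (u i) = 0 := b.zero_of_le_dist (by rw [dist_eq_norm]; exact h.le)
    have h0 : χ u = 0 := Finset.prod_eq_zero (Finset.mem_univ i) this
    simp [F, h0]
  have htsupp : tsupport F ⊆ Metric.closedBall (fun _ => 1 / 2) 1 :=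
    closure_minimal hsupp Metric.isClosed_closedBall
  refine ⟨F, ?_, ?_, ?_⟩
  · refine contDiff_iff_contDiffAt.2 fun u => ?_
    by_cases hu : u ∉ tsupport F
    · exact contDiffAt_const.congr_of_eventuallyEq (notMem_tsupport_iff_eventuallyEq.1 hu)
    rw [not_not] at hu
    have hmem : (fun j => (u j : ℂ)) ∈ polydisk r (fun _ : Fin n => (1 / 2 : ℂ)) := by
      intro i
      have h1 := htsupp hu
      rw [mem_closedBall_iff_norm, pi_norm_le_iff_of_nonneg zero_le_one] at h1
      have h2 : (u i : ℂ) - 1 / 2 = ((u i - 1 / 2 : ℝ) : ℂ) := by push_cast; rfl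
      change ‖(u i : ℂ) - 1 / 2‖ < r
      rw [h2, Complex.norm_real]
      exact (h1 i).trans_lt hr
    refine ContDiffAt.smul hχ.contDiffAt (contDiffAt_pi.2 fun i => ?_)
    have hgs : ContDiffAt ℝ (⊤ : ℕ∞) g (fun j => (u j : ℂ)) := by
      refine contDiffAt_infty.2 fun m => ?_
      exact ((contDiffOn_of_differentiableOn_complex m hopen hg).contDiffAt
        (hopen.mem_nhds hmem)).restrict_scalars ℝ
    have h3 : ContDiff ℝ (⊤ : ℕ∞) (fun v : Fin n → ℝ => fun j => (v j : ℂ)) :=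
      contDiff_pi.2 fun j => Complex.ofRealCLM.contDiff.comp (contDiff_apply ℝ ℝ j)
    have h4 : ContDiff ℝ (⊤ : ℕ∞) (fun w : Fin n → ℂ => (w i).re) :=
      Complex.reCLM.contDiff.comp (contDiff_apply ℝ ℂ i)
    exact h4.contDiffAt.comp u (hgs.comp u h3.contDiffAt)
  · exact HasCompactSupport.of_support_subset_isCompact (isCompact_closedBall _ _) hsupp
  · intro u hu
    have h1 : χ u = 1 := Finset.prod_eq_one fun i _ => by
      refine b.one_of_mem_closedBall ?_
      rw [mem_closedBall_iff_norm, Real.norm_eq_abs, abs_le]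
      constructor <;> simp only [b] <;> linarith [(hu i).1, (hu i).2]
    ext i
    simp [F, h1, hgf u hu]

theorem unitCube_eq_pi (n : ℕ) : unitCube n = univ.pi fun _ => Ioo (0 : ℝ) 1 := by
  ext u; simp [unitCube]

theorem isOpen_unitCube (n : ℕ) : IsOpen (unitCube n) := by
  rw [unitCube_eq_pi]
  exact isOpen_set_pi finite_univ fun _ _ => isOpen_Ioo

theorem IsTrajectory.congr {n : ℕ} {f F : (Fin n → ℝ) → (Fin n → ℝ)}
    (h : EqOn f F (unitCube n)) : IsTrajectory f = IsTrajectory F := by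
  ext x
  refine forall_congr' fun s => and_congr_right fun hs => ?_
  rw [h hs]

theorem flow_congr {n : ℕ} {f F : (Fin n → ℝ) → (Fin n → ℝ)} (h : EqOn f F (unitCube n)) :
    flow f = flow F := by
  unfold flow
  rw [IsTrajectory.congr h]

theorem controlMass_congr {n : ℕ} {f F : (Fin n → ℝ) → (Fin n → ℝ)} (h : EqOn f F (unitCube n)) :
    controlMass f = controlMass F := by
  unfold controlMass
  rw [flow_congr h]

theorem volumeFunction_congr {n : ℕ} {f F : (Fin n → ℝ) → (Fin n → ℝ)}
    (h : EqOn f F (unitCube n)) : volumeFunction f = volumeFunction F := by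
  unfold volumeFunction
  rw [controlMass_congr h]

theorem taylorVolume_congr {n : ℕ} {f F : (Fin n → ℝ) → (Fin n → ℝ)} (h : EqOn f F (unitCube n)) :
    taylorVolume f = taylorVolume F := by
  unfold taylorVolume
  rw [volumeFunction_congr h]

/-- Derivatives are local and the cube is open, so agreement there passes to each divergence. -/
theorem eqOn_Gam_of_eqOn {n : ℕ} {f F : (Fin n → ℝ) → (Fin n → ℝ)} (h : EqOn f F (unitCube n))
    (k : ℕ) : EqOn (Gam f k) (Gam F k) (unitCube n) := by
  induction k with
  | zero => exact fun u _ => rfl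
  | succ k ih =>
    intro u hu
    simp only [Gam, divergence]
    refine Finset.sum_congr rfl fun i _ => ?_
    rw [Filter.EventuallyEq.fderiv_eq]
    filter_upwards [(isOpen_unitCube n).mem_nhds hu] with v hv
    rw [ih hv, h hv]

/-! ### Global trajectories and invariance of the cube. -/

/-- A bounded Lipschitz field has global integral curves. -/
theorem exists_hasDerivAt_of_lipschitzWith_of_bounded {E : Type*} [NormedAddCommGroup E]
    [NormedSpace ℝ E] [CompleteSpace E] {v : E → E} {K L : NNReal} (hv : LipschitzWith K v)
    (hL : ∀ u, ‖v u‖ ≤ L) (u : E) : ∃ x : ℝ → E, x 0 = u ∧ ∀ s, HasDerivAt x (v (x s)) s := by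
  have hloc : ∀ N : ℕ, ∃ x : ℝ → E, x 0 = u ∧
      ∀ s ∈ Ioo (-(N + 1) : ℝ) (N + 1), HasDerivAt x (v (x s)) s := by
    intro N
    have hN : (0 : ℝ) ∈ Icc (-(N + 1) : ℝ) (N + 1) := by
      constructor <;> linarith [(Nat.cast_nonneg N : (0 : ℝ) ≤ N)]
    -- Since `L` bounds the field everywhere, a ball of radius `L (N + 1)` confines the solution for
    -- the whole time `N + 1`.
    have hpl : IsPicardLindelof (fun _ => v) (⟨0, hN⟩ : Icc (-(N + 1) : ℝ) (N + 1)) u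
        (L * (N + 1)) 0 L K :=
      { lipschitzOnWith := fun _ _ => hv.lipschitzOnWith
        continuousOn := fun _ _ => continuousOn_const
        norm_le := fun _ _ x _ => hL x
        mul_max_le := by simp }
    obtain ⟨x, hx0, hx⟩ := hpl.exists_eq_forall_mem_Icc_hasDerivWithinAt₀
    exact ⟨x, hx0, fun s hs => (hx s (Ioo_subset_Icc_self hs)).hasDerivAt (Icc_mem_nhds hs.1 hs.2)⟩
  choose x hx0 hx using hloc
  have hN0 : ∀ N : ℕ, (0 : ℝ) ∈ Ioo (-(N + 1) : ℝ) (N + 1) := fun N => by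
    constructor <;> linarith [(Nat.cast_nonneg N : (0 : ℝ) ≤ N)]
  have hagree : ∀ M N : ℕ, M ≤ N → EqOn (x M) (x N) (Ioo (-(M + 1) : ℝ) (M + 1)) := by
    intro M N hMN
    have hMN' : (M : ℝ) ≤ N := Nat.cast_le.2 hMN
    refine ODE_solution_unique_of_mem_Ioo (v := fun _ => v) (s := fun _ => univ) (K := K)
      (fun _ _ => hv.lipschitzOnWith) (hN0 M) (fun s hs => ⟨hx M s hs, trivial⟩)
      (fun s hs => ⟨hx N s ⟨by linarith [hs.1], by linarith [hs.2]⟩, trivial⟩) (by rw [hx0, hx0])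
  have hmem : ∀ s : ℝ, s ∈ Ioo (-((⌈|s|⌉₊ : ℕ) + 1) : ℝ) ((⌈|s|⌉₊ : ℕ) + 1) := by
    intro s
    have := Nat.le_ceil |s|
    have h2 := abs_le.1 this
    constructor <;> linarith
  have hy : ∀ N : ℕ, EqOn (fun s => x ⌈|s|⌉₊ s) (x N) (Ioo (-(N + 1) : ℝ) (N + 1)) := by
    intro N s hs
    rcases le_total ⌈|s|⌉₊ N with h | h
    · exact hagree _ _ h (hmem s)
    · exact (hagree _ _ h hs).symm
  refine ⟨fun s => x ⌈|s|⌉₊ s, hx0 _, fun s => ?_⟩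
  exact (hx _ s (hmem s)).congr_of_eventuallyEq
    ((hy _).eventuallyEq_of_mem (Ioo_mem_nhds (hmem s).1 (hmem s).2))

/-- Coordinatewise projection onto the closed unit cube. -/
def clampCube {n : ℕ} (u : Fin n → ℝ) : Fin n → ℝ := fun i => max 0 (min (u i) 1)

theorem clampCube_mem {n : ℕ} (u : Fin n → ℝ) (i : Fin n) :
    0 ≤ clampCube u i ∧ clampCube u i ≤ 1 :=
  ⟨le_max_left _ _, max_le zero_le_one (min_le_right _ _)⟩

theorem clampCube_of_mem {n : ℕ} {u : Fin n → ℝ} (hu : u ∈ unitCube n) : clampCube u = u := by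
  ext i
  rw [clampCube, min_eq_left (hu i).2.le, max_eq_right (hu i).1.le]

theorem lipschitzWith_clampCube {n : ℕ} : LipschitzWith 1 (clampCube (n := n)) := by
  refine LipschitzWith.of_dist_le_mul fun u v => ?_
  rw [dist_pi_le_iff (by positivity)]
  intro i
  exact ((((LipschitzWith.eval i).min_const 1).const_max 0).dist_le_mul u v)

/-- A curve with a given initial state in the unit cube that follows the field frozen at the
closest point of the closed cube never leaves the open cube. -/
theorem isTrajectory_of_clampCube {n : ℕ} {F : (Fin n → ℝ) → (Fin n → ℝ)} {K : NNReal}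
    (hK : LipschitzWith K F) (hbc : SatisfiesBoundaryConditions F) {x : ℝ → (Fin n → ℝ)}
    (hx : ∀ s, HasDerivAt x (F (clampCube (x s))) s) (h0 : x 0 ∈ unitCube n) :
    IsTrajectory F x := by
  have hcoord : ∀ i s, HasDerivAt (fun s => x s i) (F (clampCube (x s)) i) s := fun i s =>
    (hasDerivAt_pi.1 (hx s)) i
  -- With the other coordinates taken as known functions of time, coordinate `i` solves a scalar
  -- Lipschitz equation, which the constant `c` also solves by the boundary condition. Uniqueness
  -- keeps a curve that touches a face on it at all times, including time `0`.
  have hface : ∀ (i : Fin n) (c : ℝ), c = 0 ∨ c = 1 → ∀ s₀, x s₀ i = c → ∀ s, x s i = c := by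
    intro i c hc s₀ hs₀
    have hfix : max 0 (min c 1) = c := by rcases hc with rfl | rfl <;> simp
    have hlip : ∀ s, LipschitzWith K
        (fun y : ℝ => F (clampCube (Function.update (x s) i y)) i) := by
      intro s
      have h1 : LipschitzWith 1 (fun y : ℝ => Function.update (x s) i y) := by
        refine LipschitzWith.of_dist_le_mul fun y z => ?_
        rw [dist_pi_le_iff (by positivity)]
        intro j
        rcases eq_or_ne j i with rfl | hj
        · simp
        · simp [hj]
      simpa [Function.comp_def] using (LipschitzWith.eval i).comp (hK.comp (lipschitzWith_clampCube.comp h1))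
    have := ODE_solution_unique_univ (K := K) (s := fun _ => univ) (t₀ := s₀)
      (v := fun s y => F (clampCube (Function.update (x s) i y)) i)
      (f := fun s => x s i) (g := fun _ => c) (fun s => (hlip s).lipschitzOnWith)
      (fun s => ⟨by simpa using hcoord i s, trivial⟩)
      (fun s => ⟨by
        have hz : F (clampCube (Function.update (x s) i c)) i = 0 := by
          refine hbc _ (clampCube_mem _) i ?_
          simpa [clampCube, hfix] using hc
        simpa [hz] using hasDerivAt_const s c, trivial⟩) hs₀
    exact fun s => congrFun this s
  have hcont : ∀ i, Continuous fun s => x s i := fun i =>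
    continuous_iff_continuousAt.2 fun s => (hcoord i s).continuousAt
  have hmem : ∀ s, x s ∈ unitCube n := by
    intro s i
    constructor
    · by_contra! hle
      obtain ⟨s₀, hs₀⟩ := mem_range_of_exists_le_of_exists_ge (hcont i) ⟨s, hle⟩ ⟨0, (h0 i).1.le⟩
      exact (h0 i).1.ne' (hface i 0 (Or.inl rfl) s₀ hs₀ 0)
    · by_contra! hle
      obtain ⟨s₀, hs₀⟩ := mem_range_of_exists_le_of_exists_ge (hcont i) ⟨0, (h0 i).2.le⟩ ⟨s, hle⟩
      exact (h0 i).2.ne (hface i 1 (Or.inr rfl) s₀ hs₀ 0)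
  exact fun s => ⟨hmem s, by simpa [clampCube_of_mem (hmem s)] using hx s⟩

/-! ### The flow as a group, and its dependence on the initial state. -/

section Flow

variable {n : ℕ} {F : (Fin n → ℝ) → (Fin n → ℝ)} {K : NNReal}

theorem exists_isTrajectory (hK : LipschitzWith K F) (hbc : SatisfiesBoundaryConditions F)
    {u : Fin n → ℝ} (hu : u ∈ unitCube n) : ∃ x, IsTrajectory F x ∧ x 0 = u := by
  have hcomp : IsCompact (univ.pi fun _ : Fin n => Icc (0 : ℝ) 1) :=
    isCompact_univ_pi fun _ => isCompact_Icc
  obtain ⟨L, hL⟩ := hcomp.exists_bound_of_continuousOn hK.continuous.continuousOn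
  have hL' : ∀ u, ‖F (clampCube u)‖ ≤ L.toNNReal := fun u =>
    (hL _ fun i _ => clampCube_mem u i).trans (Real.le_coe_toNNReal L)
  obtain ⟨x, hx0, hx⟩ := exists_hasDerivAt_of_lipschitzWith_of_bounded
    (hK.comp lipschitzWith_clampCube) hL' u
  exact ⟨x, isTrajectory_of_clampCube hK hbc hx (hx0 ▸ hu), hx0⟩

theorem IsTrajectory.unique (hK : LipschitzWith K F) {x y : ℝ → (Fin n → ℝ)}
    (hx : IsTrajectory F x) (hy : IsTrajectory F y) (h : x 0 = y 0) : x = y :=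
  ODE_solution_unique_univ (v := fun _ => F) (s := fun _ => univ) (t₀ := 0)
    (fun _ => hK.lipschitzOnWith) (fun s => ⟨(hx s).2, trivial⟩) (fun s => ⟨(hy s).2, trivial⟩) h

/-- On the cube the default value in `flow` never occurs, so the chosen curve is a genuine
trajectory. -/
theorem flow_spec (hK : LipschitzWith K F) (hbc : SatisfiesBoundaryConditions F)
    {u : Fin n → ℝ} (hu : u ∈ unitCube n) : IsTrajectory F (flow F u) ∧ flow F u 0 = u := by
  have h := exists_isTrajectory hK hbc hu
  have : flow F u = h.choose := by
    ext1 s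
    rw [flow, dif_pos h]
  rw [this]
  exact h.choose_spec

theorem flow_mem (hK : LipschitzWith K F) (hbc : SatisfiesBoundaryConditions F)
    {u : Fin n → ℝ} (hu : u ∈ unitCube n) (s : ℝ) : flow F u s ∈ unitCube n :=
  ((flow_spec hK hbc hu).1 s).1

theorem flow_add (hK : LipschitzWith K F) (hbc : SatisfiesBoundaryConditions F)
    {u : Fin n → ℝ} (hu : u ∈ unitCube n) (s t : ℝ) :
    flow F u (s + t) = flow F (flow F u s) t := by
  have h1 := (flow_spec hK hbc hu).1
  have h2 := flow_spec hK hbc (flow_mem hK hbc hu s)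
  have h3 : IsTrajectory F fun t => flow F u (s + t) := fun t =>
    ⟨(h1 _).1, (h1 _).2.comp_const_add s t⟩
  exact congrFun (h3.unique hK h2.1 (by simp [h2.2])) t

theorem flow_neg_flow (hK : LipschitzWith K F) (hbc : SatisfiesBoundaryConditions F)
    {u : Fin n → ℝ} (hu : u ∈ unitCube n) (s : ℝ) : flow F (flow F u s) (-s) = u := by
  rw [← flow_add hK hbc hu, add_neg_cancel, (flow_spec hK hbc hu).2]

/-- Grönwall's inequality; negative times are handled by the reversed field `-F`. -/
theorem dist_flow_le (hK : LipschitzWith K F) (hbc : SatisfiesBoundaryConditions F)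
    {u v : Fin n → ℝ} (hu : u ∈ unitCube n) (hv : v ∈ unitCube n) (s : ℝ) :
    dist (flow F u s) (flow F v s) ≤ dist u v * Real.exp (K * |s|) := by
  have hpos : ∀ {G : (Fin n → ℝ) → (Fin n → ℝ)} {x y : ℝ → (Fin n → ℝ)}, LipschitzWith K G →
      (∀ s, HasDerivAt x (G (x s)) s) → (∀ s, HasDerivAt y (G (y s)) s) → ∀ s, 0 ≤ s →
      dist (x s) (y s) ≤ dist (x 0) (y 0) * Real.exp (K * s) := by
    intro G x y hG hx hy s hs
    have hxc : Continuous x := continuous_iff_continuousAt.2 fun s => (hx s).continuousAt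
    have hyc : Continuous y := continuous_iff_continuousAt.2 fun s => (hy s).continuousAt
    simpa using dist_le_of_trajectories_ODE (v := fun _ => G) (a := 0) (b := s) (fun _ => hG)
      hxc.continuousOn (fun t _ => (hx t).hasDerivWithinAt) hyc.continuousOn
      (fun t _ => (hy t).hasDerivWithinAt) le_rfl s ⟨hs, le_rfl⟩
  obtain ⟨hx, hx0⟩ := flow_spec hK hbc hu
  obtain ⟨hy, hy0⟩ := flow_spec hK hbc hv
  rcases le_total 0 s with hs | hs
  · simpa [hx0, hy0, abs_of_nonneg hs] using
      hpos hK (fun s => (hx s).2) (fun s => (hy s).2) s hs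
  · have hrev : ∀ {x : ℝ → (Fin n → ℝ)}, IsTrajectory F x →
        ∀ s, HasDerivAt (fun s => x (-s)) (-F (x (-s))) s := by
      intro x hx s
      simpa [Function.comp_def] using (hx (-s)).2.scomp s (hasDerivAt_neg s)
    simpa [hx0, hy0, abs_of_nonpos hs] using
      hpos (G := fun u => -F u) hK.neg (hrev hx) (hrev hy) (-s) (by linarith)

/-- The deviation of the flow from its first order approximation in time has a Lipschitz constant
of second order. -/
theorem norm_flow_sub_euler_le (hK : LipschitzWith K F) (hbc : SatisfiesBoundaryConditions F)
    (hF : Differentiable ℝ F) {K₂ : NNReal} (hK₂ : LipschitzWith K₂ fun u => fderiv ℝ F u (F u))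
    {u v : Fin n → ℝ} (hu : u ∈ unitCube n) (hv : v ∈ unitCube n) {h : ℝ} (hh : |h| ≤ 1) :
    ‖(flow F u h - u - h • F u) - (flow F v h - v - h • F v)‖ ≤
      K₂ * Real.exp K * h ^ 2 * ‖u - v‖ := by
  obtain ⟨hx, hx0⟩ := flow_spec hK hbc hu
  obtain ⟨hy, hy0⟩ := flow_spec hK hbc hv
  set x := flow F u
  set y := flow F v
  set C : ℝ := K₂ * Real.exp K * ‖u - v‖
  have hC : 0 ≤ C := by positivity
  have hH : ∀ {x : ℝ → (Fin n → ℝ)}, IsTrajectory F x →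
      ∀ s, HasDerivAt (fun s => F (x s)) (fderiv ℝ F (x s) (F (x s))) s := fun hx s =>
    (hF _).hasFDerivAt.comp_hasDerivAt s (hx s).2
  have hball : ∀ s ∈ Icc (-|h|) |h|, |s| ≤ |h| := fun s hs => abs_le.2 hs
  have h0mem : (0 : ℝ) ∈ Icc (-|h|) |h| := by simp
  have hhmem : h ∈ Icc (-|h|) |h| := abs_le.1 le_rfl
  -- The derivative of `F` along a trajectory is `DF · F`, which is `K₂`-Lipschitz. Two applications
  -- of the mean value inequality, here to the velocities and then to the positions, give the factor
  -- `h²`.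
  have h1 : ∀ s ∈ Icc (-|h|) |h|, ‖(F (x s) - F (y s)) - (F u - F v)‖ ≤ C * |h| := by
    intro s hs
    have := (convex_Icc (-|h|) |h|).norm_image_sub_le_of_norm_hasDerivWithin_le
      (f := fun s => F (x s) - F (y s)) (C := C)
      (fun s _ => ((hH hx s).sub (hH hy s)).hasDerivWithinAt) (fun s hs => by
        have h2 := hK₂.dist_le_mul (x s) (y s)
        have h3 := dist_flow_le hK hbc hu hv s
        rw [dist_eq_norm] at h2
        refine h2.trans ?_
        have h4 : Real.exp (K * |s|) ≤ Real.exp K := by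
          rw [Real.exp_le_exp]
          exact mul_le_of_le_one_right K.2 ((hball s hs).trans hh)
        calc (K₂ : ℝ) * dist (x s) (y s) ≤ K₂ * (dist u v * Real.exp (K * |s|)) := by gcongr
          _ ≤ K₂ * (dist u v * Real.exp K) := by gcongr
          _ = C := by rw [dist_eq_norm]; ring) h0mem hs
    simp only [hx0, hy0, sub_zero, Real.norm_eq_abs] at this
    exact this.trans (mul_le_mul_of_nonneg_left (hball s hs) hC)
  have := (convex_Icc (-|h|) |h|).norm_image_sub_le_of_norm_hasDerivWithin_le
    (f := fun s => x s - y s - s • (F u - F v)) (C := C * |h|)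
    (fun s _ => ((((hx s).2.sub (hy s).2).sub
      ((hasDerivAt_id s).smul_const (F u - F v)))).hasDerivWithinAt)
    (fun s hs => by simpa using h1 s hs) h0mem hhmem
  simp only [hx0, hy0, zero_smul, sub_zero, Real.norm_eq_abs] at this
  calc _ = ‖x h - y h - h • (F u - F v) - (u - v)‖ := by congr 1; rw [smul_sub]; abel
    _ ≤ _ := this
    _ = _ := by rw [mul_assoc, ← pow_two, sq_abs]; ring

end Flow

/-! ### Infinitesimal change of volume and density along the flow. -/

/-- The determinant is differentiable at the identity, with the trace as derivative. -/
theorem exists_abs_det_one_add_sub_le (n : ℕ) {ε : ℝ} (hε : 0 < ε) :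
    ∃ δ > 0, ∀ M : (Fin n → ℝ) →L[ℝ] (Fin n → ℝ), ‖M‖ ≤ δ →
      |(1 + M).det - 1 - ∑ i, M (Pi.single i 1) i| ≤ ε * ‖M‖ := by
  have hdet : ∀ M : (Fin n → ℝ) →L[ℝ] (Fin n → ℝ),
      M.det = (Matrix.of fun i j => M (Pi.single j 1) i).det := by
    intro M
    rw [ContinuousLinearMap.det, ← LinearMap.det_toMatrix']
    congr 1
  have hdiff : Differentiable ℝ fun M : (Fin n → ℝ) →L[ℝ] (Fin n → ℝ) => (1 + M).det := by
    simp only [hdet, Matrix.det_apply, Matrix.of_apply]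
    refine Differentiable.fun_sum fun σ _ => Differentiable.const_smul ?_ _
    have hentry : ∀ i j, Differentiable ℝ
        fun M : (Fin n → ℝ) →L[ℝ] (Fin n → ℝ) => (1 + M) (Pi.single i 1) j := fun i j M =>
      differentiableAt_pi.1 ((((differentiable_const _).add differentiable_id).clm_apply
        (differentiable_const _)) M) j
    have hprod := fun M => HasFDerivAt.finsetProd (u := Finset.univ)
      fun i (_ : i ∈ Finset.univ) => (hentry i (σ i) M).hasFDerivAt
    exact fun M => by simpa [Finset.prod_fn] using (hprod M).differentiableAt
  have h0 := (hdiff 0).hasFDerivAt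
  have htr : ∀ M, fderiv ℝ (fun M : (Fin n → ℝ) →L[ℝ] (Fin n → ℝ) => (1 + M).det) 0 M =
      ∑ i, M (Pi.single i 1) i := by
    intro M
    have h1 : HasDerivAt (fun r : ℝ => r • M) M 0 := by
      simpa using (hasDerivAt_id (0 : ℝ)).smul_const M
    have h2 := HasFDerivAt.comp_hasDerivAt (0 : ℝ) (by simpa using h0) h1
    set A : Matrix (Fin n) (Fin n) ℝ := Matrix.of fun i j => M (Pi.single j 1) i with hA
    -- On the line through `M`, `det (1 + r A)` is `1 + r tr A` plus `r²` times a polynomial in `r`,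
    -- so the derivative at `0` is the trace.
    have h3 : ((fun M : (Fin n → ℝ) →L[ℝ] (Fin n → ℝ) => (1 + M).det) ∘ fun r : ℝ => r • M) =
        fun r => 1 + A.trace * r +
          (Matrix.det (1 + (Polynomial.X : Polynomial ℝ) • A.map Polynomial.C)).divX.divX.eval r
            * r ^ 2 := by
      ext r
      rw [← Matrix.det_one_add_smul, Function.comp_apply, hdet]
      congr 1
      ext i j
      simp [hA, Matrix.one_apply, Pi.single_apply]
    have h4 : HasDerivAt (fun r : ℝ => 1 + A.trace * r +
          (Matrix.det (1 + (Polynomial.X : Polynomial ℝ) • A.map Polynomial.C)).divX.divX.eval r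
            * r ^ 2) A.trace 0 := by
      have h5 := ((hasDerivAt_id (0 : ℝ)).const_mul A.trace).const_add 1
      have h6 := ((Matrix.det (1 + (Polynomial.X : Polynomial ℝ) •
        A.map Polynomial.C)).divX.divX.hasDerivAt 0).mul ((hasDerivAt_id (0 : ℝ)).pow 2)
      refine (h5.add h6).congr_deriv ?_
      simp
    rw [h3] at h2
    rw [h2.unique h4]
    rfl
  have h1 := (hasFDerivAt_iff_isLittleO.1 h0).bound hε
  obtain ⟨δ, hδ, hb⟩ := Metric.eventually_nhds_iff.1 h1
  refine ⟨δ / 2, half_pos hδ, fun M hM => ?_⟩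
  have := hb (y := M) (by rw [dist_zero_right]; linarith)
  rw [htr, sub_zero] at this
  simpa [ContinuousLinearMap.det] using this

theorem exists_abs_le_on_unitCube {n : ℕ} {g : (Fin n → ℝ) → ℝ} (hg : Continuous g) :
    ∃ B, 0 ≤ B ∧ ∀ u ∈ unitCube n, |g u| ≤ B := by
  have hcomp : IsCompact (univ.pi fun _ : Fin n => Icc (0 : ℝ) 1) :=
    isCompact_univ_pi fun _ => isCompact_Icc
  obtain ⟨B, hB⟩ := hcomp.exists_bound_of_continuousOn hg.continuousOn
  exact ⟨|B|, abs_nonneg _, fun u hu =>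
    (hB u fun i _ => ⟨(hu i).1.le, (hu i).2.le⟩).trans (le_abs_self B)⟩

section Transport

variable {n : ℕ} {F : (Fin n → ℝ) → (Fin n → ℝ)} {K : NNReal}

theorem divergence_eq_sum {u : Fin n → ℝ} (hF : DifferentiableAt ℝ F u) :
    divergence F u = ∑ i, fderiv ℝ F u (Pi.single i 1) i := by
  refine Finset.sum_congr rfl fun i _ => ?_
  rw [fderiv_apply hF]
  rfl

theorem divergence_smul {G : (Fin n → ℝ) → ℝ} {u : Fin n → ℝ} (hG : DifferentiableAt ℝ G u)
    (hF : DifferentiableAt ℝ F u) :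
    divergence (fun v => G v • F v) u = G u * divergence F u + fderiv ℝ G u (F u) := by
  rw [divergence_eq_sum (hG.fun_smul hF), divergence_eq_sum hF, fderiv_fun_smul hG hF,
    Finset.mul_sum]
  have : fderiv ℝ G u (F u) = ∑ i, F u i * fderiv ℝ G u (Pi.single i 1) := by
    conv_lhs => rw [pi_eq_sum_univ' (F u)]
    simp [map_sum]
  rw [this, ← Finset.sum_add_distrib]
  refine Finset.sum_congr rfl fun i _ => ?_
  simp [mul_comm]

theorem ContDiff.divergence (hF : ContDiff ℝ (⊤ : ℕ∞) F) :
    ContDiff ℝ (⊤ : ℕ∞) (divergence F) := by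
  unfold _root_.divergence
  refine ContDiff.sum fun i _ => ?_
  exact ((contDiff_pi.1 hF i).fderiv_right (m := (⊤ : ℕ∞)) (by simp)).clm_apply contDiff_const

theorem ContDiff.Gam (hF : ContDiff ℝ (⊤ : ℕ∞) F) (k : ℕ) : ContDiff ℝ (⊤ : ℕ∞) (Gam F k) := by
  induction k with
  | zero => exact contDiff_const
  | succ k ih => exact (ih.smul hF).divergence

/-- First order expansion in time of a smooth function along the flow. -/
theorem exists_abs_comp_flow_sub_le (hK : LipschitzWith K F) (hbc : SatisfiesBoundaryConditions F)
    (hF : ContDiff ℝ (⊤ : ℕ∞) F) {G : (Fin n → ℝ) → ℝ} (hG : ContDiff ℝ (⊤ : ℕ∞) G) :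
    ∃ C, 0 ≤ C ∧ ∀ h : ℝ, ∀ u ∈ unitCube n,
      |G (flow F u h) - G u - h * fderiv ℝ G u (F u)| ≤ C * h ^ 2 := by
  have hder : ∀ {G : (Fin n → ℝ) → ℝ}, ContDiff ℝ (⊤ : ℕ∞) G →
      ContDiff ℝ (⊤ : ℕ∞) fun u => fderiv ℝ G u (F u) := fun hG =>
    (hG.fderiv_right (m := (⊤ : ℕ∞)) (by simp)).clm_apply hF
  have halong : ∀ {G : (Fin n → ℝ) → ℝ}, ContDiff ℝ (⊤ : ℕ∞) G → ∀ {x}, IsTrajectory F x →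
      ∀ s, HasDerivAt (fun s => G (x s)) (fderiv ℝ G (x s) (F (x s))) s := fun hG x hx s =>
    (hG.differentiable (by simp) _).hasFDerivAt.comp_hasDerivAt s (hx s).2
  obtain ⟨C, hC0, hC⟩ := exists_abs_le_on_unitCube (hder (hder hG)).continuous
  refine ⟨C, hC0, fun h u hu => ?_⟩
  obtain ⟨hx, hx0⟩ := flow_spec hK hbc hu
  set x := flow F u
  have h0mem : (0 : ℝ) ∈ Icc (-|h|) |h| := by simp
  have h1 : ∀ s ∈ Icc (-|h|) |h|,
      |fderiv ℝ G (x s) (F (x s)) - fderiv ℝ G u (F u)| ≤ C * |h| := by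
    intro s hs
    have := (convex_Icc (-|h|) |h|).norm_image_sub_le_of_norm_hasDerivWithin_le (C := C)
      (fun s _ => (halong (hder hG) hx s).hasDerivWithinAt) (fun s _ => hC _ (hx s).1) h0mem hs
    simp only [hx0, sub_zero, Real.norm_eq_abs] at this
    exact this.trans (mul_le_mul_of_nonneg_left (abs_le.2 hs) hC0)
  have := (convex_Icc (-|h|) |h|).norm_image_sub_le_of_norm_hasDerivWithin_le
    (f := fun s => G (x s) - s * fderiv ℝ G u (F u)) (C := C * |h|)
    (fun s _ => ((halong hG hx s).sub
      ((hasDerivAt_id s).mul_const (fderiv ℝ G u (F u)))).hasDerivWithinAt)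
    (fun s hs => by simpa using h1 s hs) h0mem (abs_le.1 (le_refl |h|))
  simp only [hx0, zero_mul, sub_zero, Real.norm_eq_abs] at this
  rw [mul_assoc, ← pow_two, sq_abs] at this
  rwa [sub_right_comm]

/-- First order expansion in time of the Jacobian determinant of the flow. -/
theorem exists_abs_det_fderiv_flow_sub_le (hK : LipschitzWith K F)
    (hbc : SatisfiesBoundaryConditions F) (hF : ContDiff ℝ (⊤ : ℕ∞) F) {K₂ : NNReal}
    (hK₂ : LipschitzWith K₂ fun u => fderiv ℝ F u (F u)) {ε : ℝ} (hε : 0 < ε) :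
    ∃ η > 0, ∀ h : ℝ, |h| ≤ η → ∀ u ∈ unitCube n, DifferentiableAt ℝ (fun v => flow F v h) u →
      |(|(fderiv ℝ (fun v => flow F v h) u).det|) - 1 - h * divergence F u| ≤ ε * |h| := by
  have hFd : Differentiable ℝ F := hF.differentiable (by simp)
  obtain ⟨B, hB0, hB⟩ := exists_abs_le_on_unitCube hF.divergence.continuous
  set C : ℝ := K₂ * Real.exp K with hCdef
  have hC : 0 ≤ C := by positivity
  set ε₁ := ε / (2 * (K + C + 1)) with hε₁
  have hε₁0 : 0 < ε₁ := by positivity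
  obtain ⟨δ, hδ, hdet⟩ := exists_abs_det_one_add_sub_le n hε₁0
  -- The bounds serve, in order: the Euler estimate, the range of the determinant expansion, the
  -- `h²` error in the trace, and positivity of the determinant.
  set η := min (min 1 (δ / (K + C + 1))) (min (ε / (2 * (n * C + 1))) (1 / (ε + B + 1))) with hη
  refine ⟨η, by positivity, fun h hh u hu hd => ?_⟩
  have hh1 : |h| ≤ 1 := hh.trans ((min_le_left _ _).trans (min_le_left _ _))
  have hhδ : |h| * (K + C + 1) ≤ δ := by
    rw [← le_div_iff₀ (by positivity)]
    exact hh.trans ((min_le_left _ _).trans (min_le_right _ _))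
  have hhε : |h| * (2 * (n * C + 1)) ≤ ε := by
    rw [← le_div_iff₀ (by positivity)]
    exact hh.trans ((min_le_right _ _).trans (min_le_left _ _))
  have hhB : |h| * (ε + B + 1) ≤ 1 := by
    rw [← le_div_iff₀ (by positivity)]
    exact hh.trans ((min_le_right _ _).trans (min_le_right _ _))
  set D := fderiv ℝ (fun v => flow F v h) u with hD
  -- A derivative is bounded by a local Lipschitz constant, so the estimate on differences of flow
  -- values becomes one on the Jacobian.
  have hdev : ‖D - 1 - h • fderiv ℝ F u‖ ≤ C * h ^ 2 := by
    have h1 : HasFDerivAt (fun v => flow F v h - v - h • F v) (D - 1 - h • fderiv ℝ F u) u :=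
      (hd.hasFDerivAt.sub (hasFDerivAt_id u)).sub ((hFd u).hasFDerivAt.const_smul h)
    refine h1.le_of_lip' (by positivity) ?_
    filter_upwards [(isOpen_unitCube n).mem_nhds hu] with v hv
    exact norm_flow_sub_euler_le hK hbc hFd hK₂ hv hu hh1
  have hDF : ‖fderiv ℝ F u‖ ≤ K := norm_fderiv_le_of_lipschitz ℝ hK
  have hsq : h ^ 2 = |h| * |h| := by rw [← pow_two, sq_abs]
  have hM : ‖D - 1‖ ≤ (K + C) * |h| := by
    calc ‖D - 1‖ = ‖(D - 1 - h • fderiv ℝ F u) + h • fderiv ℝ F u‖ := by rw [sub_add_cancel]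
      _ ≤ C * h ^ 2 + |h| * K := by
        refine (norm_add_le _ _).trans (add_le_add hdev ?_)
        rw [norm_smul, Real.norm_eq_abs]
        gcongr
      _ ≤ C * (|h| * 1) + |h| * K := by rw [hsq]; gcongr
      _ = _ := by ring
  have h2 := hdet (D - 1) (hM.trans (by nlinarith [abs_nonneg h]))
  rw [add_sub_cancel] at h2
  have h3 : |∑ i, (D - 1) (Pi.single i 1) i - h * divergence F u| ≤ n * (C * h ^ 2) := by
    rw [divergence_eq_sum (hFd u), Finset.mul_sum, ← Finset.sum_sub_distrib]
    refine (Finset.abs_sum_le_sum_abs _ _).trans ?_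
    have : ∀ i ∈ (Finset.univ : Finset (Fin n)), |(D - 1) (Pi.single i 1) i -
        h * fderiv ℝ F u (Pi.single i 1) i| ≤ C * h ^ 2 := by
      intro i _
      have h4 : (D - 1) (Pi.single i 1) i - h * fderiv ℝ F u (Pi.single i 1) i =
          (D - 1 - h • fderiv ℝ F u) (Pi.single i 1) i := by simp
      rw [h4]
      refine (norm_le_pi_norm ((D - 1 - h • fderiv ℝ F u) (Pi.single i 1)) i).trans ?_
      refine (ContinuousLinearMap.le_opNorm _ _).trans ?_
      rw [Pi.norm_single, norm_one, mul_one]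
      exact hdev
    simpa using Finset.sum_le_sum this
  have h4 : |D.det - 1 - h * divergence F u| ≤ ε * |h| := by
    calc |D.det - 1 - h * divergence F u|
        = |(D.det - 1 - ∑ i, (D - 1) (Pi.single i 1) i) +
            (∑ i, (D - 1) (Pi.single i 1) i - h * divergence F u)| := by congr 1; ring
      _ ≤ ε₁ * ((K + C) * |h|) + n * (C * h ^ 2) := by
        refine (abs_add_le _ _).trans (add_le_add (h2.trans ?_) h3)
        gcongr
      _ ≤ ε / 2 * |h| + ε / 2 * |h| := by
        refine add_le_add ?_ ?_
        · have : ε₁ * (K + C + 1) = ε / 2 := by rw [hε₁]; field_simp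
          nlinarith [mul_nonneg hε₁0.le (abs_nonneg h)]
        · rw [hsq]
          nlinarith [abs_nonneg h]
      _ = ε * |h| := by ring
  -- For small `h` the determinant is close to `1`, so its absolute value can be dropped.
  have hpos : 0 ≤ D.det := by
    have h5 := (abs_le.1 h4).1
    have h6 : |h * divergence F u| ≤ |h| * B := by
      rw [abs_mul]
      exact mul_le_mul_of_nonneg_left (hB u hu) (abs_nonneg _)
    have h7 := (abs_le.1 h6).1
    nlinarith [abs_nonneg h]
  rwa [abs_of_nonneg hpos]

/-- First order expansion in time of the transported density. -/
theorem exists_abs_transport_sub_le (hK : LipschitzWith K F)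
    (hbc : SatisfiesBoundaryConditions F) (hF : ContDiff ℝ (⊤ : ℕ∞) F) {K₂ : NNReal}
    (hK₂ : LipschitzWith K₂ fun u => fderiv ℝ F u (F u)) {G : (Fin n → ℝ) → ℝ}
    (hG : ContDiff ℝ (⊤ : ℕ∞) G) {ε : ℝ} (hε : 0 < ε) :
    ∃ η > 0, ∀ h : ℝ, |h| ≤ η → ∀ u ∈ unitCube n, DifferentiableAt ℝ (fun v => flow F v h) u →
      |(|(fderiv ℝ (fun v => flow F v h) u).det|) * G (flow F u h) - G u -
        h * divergence (fun v => G v • F v) u| ≤ ε * |h| := by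
  obtain ⟨C, hC0, hC⟩ := exists_abs_comp_flow_sub_le hK hbc hF hG
  obtain ⟨B₁, hB₁0, hB₁⟩ := exists_abs_le_on_unitCube hG.continuous
  obtain ⟨B₂, hB₂0, hB₂⟩ := exists_abs_le_on_unitCube hF.divergence.continuous
  obtain ⟨B₃, hB₃0, hB₃⟩ := exists_abs_le_on_unitCube
    ((hG.fderiv_right (m := (⊤ : ℕ∞)) (by simp)).clm_apply hF).continuous
  set ε₁ := ε / (2 * (B₁ + 1)) with hε₁
  have hε₁0 : 0 < ε₁ := by positivity
  obtain ⟨η, hη, hdet⟩ := exists_abs_det_fderiv_flow_sub_le hK hbc hF hK₂ hε₁0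
  set Q := (1 + B₂) * C + B₂ * B₃ + 1 with hQ
  have hQ0 : 0 < Q := by positivity
  refine ⟨min (min η 1) (ε / (2 * Q)), by positivity, fun h hh u hu hd => ?_⟩
  have hh0 := abs_nonneg h
  have hh1 : |h| ≤ 1 := hh.trans ((min_le_left _ _).trans (min_le_right _ _))
  have hhQ : |h| * (2 * Q) ≤ ε := by
    rw [← le_div_iff₀ (by positivity)]
    exact hh.trans (min_le_right _ _)
  have h1 := hdet h (hh.trans ((min_le_left _ _).trans (min_le_left _ _))) u hu hd
  have h2 := hC h u hu
  rw [divergence_smul (hG.differentiable (by simp) u) (hF.differentiable (by simp) u)]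
  have hb := hB₁ _ (flow_mem hK hbc hu h)
  have hθ := hB₂ u hu
  have hγ := hB₃ u hu
  generalize |(fderiv ℝ (fun v => flow F v h) u).det| = a at *
  generalize G (flow F u h) = b at *
  generalize divergence F u = θ at *
  generalize fderiv ℝ G u (F u) = γ at *
  have hsq : h ^ 2 = |h| * |h| := by rw [← pow_two, sq_abs]
  -- The product of the expansions of the Jacobian `a` and of the transported value `b` is split
  -- into the two separate errors and the cross term `h² θ γ`.
  calc |a * b - G u - h * (G u * θ + γ)|
      = |(a - 1 - h * θ) * b + (1 + h * θ) * (b - G u - h * γ) + h ^ 2 * (θ * γ)| := by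
        congr 1; ring
    _ ≤ |a - 1 - h * θ| * |b| + |1 + h * θ| * |b - G u - h * γ| + h ^ 2 * (|θ| * |γ|) := by
        refine (abs_add_three _ _ _).trans (le_of_eq ?_)
        simp only [abs_mul, abs_pow, sq_abs]
    _ ≤ (ε₁ * |h|) * B₁ + (1 + 1 * B₂) * (C * h ^ 2) + h ^ 2 * (B₂ * B₃) := by
        gcongr
        refine (abs_add_le _ _).trans ?_
        rw [abs_one, abs_mul]
        gcongr
    _ ≤ ε / 2 * |h| + |h| * Q * |h| := by
        have : ε₁ * (B₁ + 1) = ε / 2 := by rw [hε₁]; field_simp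
        rw [hsq, hQ]
        nlinarith [mul_nonneg hε₁0.le hh0, mul_nonneg hh0 hh0]
    _ ≤ ε * |h| := by nlinarith

end Transport

/-! ### Change of variables and the Reynolds transport theorem. -/

theorem integrableOn_unitCube {n : ℕ} {G : (Fin n → ℝ) → ℝ} (hG : Continuous G)
    {A : Set (Fin n → ℝ)} (hA : A ⊆ unitCube n) : IntegrableOn G A := by
  have hcomp : IsCompact (univ.pi fun _ : Fin n => Icc (0 : ℝ) 1) :=
    isCompact_univ_pi fun _ => isCompact_Icc
  exact (hG.continuousOn.integrableOn_compact hcomp).mono_set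
    (hA.trans fun u hu i _ => ⟨(hu i).1.le, (hu i).2.le⟩)

theorem volume_unitCube (n : ℕ) : volume (unitCube n) = 1 := by
  rw [unitCube_eq_pi, Real.volume_pi_Ioo]
  simp

/-- For the sup norm, Lebesgue measure is the `n`-dimensional Hausdorff measure, which a Lipschitz
map increases by at most a constant factor. -/
theorem volume_image_eq_zero_of_lipschitzOnWith {n : ℕ} {φ : (Fin n → ℝ) → (Fin n → ℝ)}
    {K : NNReal} {A : Set (Fin n → ℝ)} (hφ : LipschitzOnWith K φ A) (hA : volume A = 0) :
    volume (φ '' A) = 0 := by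
  rw [← hausdorffMeasure_pi_real] at hA ⊢
  refine le_antisymm ((hφ.hausdorffMeasure_image_le (by positivity)).trans ?_) zero_le
  rw [hA, mul_zero]

section Transport

variable {n : ℕ} {F : (Fin n → ℝ) → (Fin n → ℝ)} {K : NNReal}

theorem lipschitzOnWith_flow (hK : LipschitzWith K F) (hbc : SatisfiesBoundaryConditions F)
    (h : ℝ) : LipschitzOnWith (Real.exp (K * |h|)).toNNReal (fun u => flow F u h) (unitCube n) := by
  refine LipschitzOnWith.of_dist_le_mul fun u hu v hv => ?_
  rw [Real.coe_toNNReal _ (Real.exp_pos _).le, mul_comm]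
  exact dist_flow_le hK hbc hu hv h

theorem injOn_flow (hK : LipschitzWith K F) (hbc : SatisfiesBoundaryConditions F)
    (h : ℝ) : InjOn (fun u => flow F u h) (unitCube n) := by
  intro u hu v hv huv
  rw [← flow_neg_flow hK hbc hu h, ← flow_neg_flow hK hbc hv h]
  exact congrArg (flow F · (-h)) huv

/-- Rademacher's theorem; openness of the cube upgrades the derivative within it to a full one. -/
theorem ae_differentiableAt_flow (hK : LipschitzWith K F) (hbc : SatisfiesBoundaryConditions F)
    (h : ℝ) : ∀ᵐ u, u ∈ unitCube n → DifferentiableAt ℝ (fun u => flow F u h) u := by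
  filter_upwards [(lipschitzOnWith_flow hK hbc h).ae_differentiableWithinAt_of_mem
    (μ := volume)] with u hu hmem
  exact (hu hmem).differentiableAt ((isOpen_unitCube n).mem_nhds hmem)

/-- Change of variables along the flow. -/
theorem integral_image_flow (hK : LipschitzWith K F) (hbc : SatisfiesBoundaryConditions F)
    {G : (Fin n → ℝ) → ℝ} (hG : Continuous G) {A : Set (Fin n → ℝ)} (hAm : MeasurableSet A)
    (hA : A ⊆ unitCube n) (h : ℝ) :
    IntegrableOn (fun u => |(fderiv ℝ (fun v => flow F v h) u).det| * G (flow F u h)) A ∧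
      ∫ u in (fun u => flow F u h) '' A, G u =
        ∫ u in A, |(fderiv ℝ (fun v => flow F v h) u).det| * G (flow F u h) := by
  set φ : (Fin n → ℝ) → (Fin n → ℝ) := fun u => flow F u h
  -- The change of variables is applied on the points of differentiability. The remainder of `A` is
  -- null, and so is its image because the flow is Lipschitz.
  set D := {u | DifferentiableAt ℝ φ u}
  have hD : MeasurableSet D := measurableSet_of_differentiableAt ℝ φ
  have hnull : volume (A \ D) = 0 := by
    refine measure_mono_null ?_ (ae_iff.1 (ae_differentiableAt_flow hK hbc h))
    intro u hu
    exact fun hdiff => hu.2 (hdiff (hA hu.1))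
  have hae : (A ∩ D : Set _) =ᵐ[volume] A := by
    refine ae_eq_set.2 ⟨?_, ?_⟩
    · rw [sdiff_eq_empty.2 inter_subset_left, measure_empty]
    · rwa [sdiff_self_inter]
  have haeimg : (φ '' (A ∩ D) : Set _) =ᵐ[volume] φ '' A := by
    refine ae_eq_set.2 ⟨?_, ?_⟩
    · rw [sdiff_eq_empty.2 (image_mono inter_subset_left), measure_empty]
    · have hsub : φ '' A \ φ '' (A ∩ D) ⊆ φ '' (A \ D) := by
        rintro _ ⟨⟨u, hu, rfl⟩, hnot⟩
        exact ⟨u, ⟨hu, fun hD => hnot ⟨u, ⟨hu, hD⟩, rfl⟩⟩, rfl⟩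
      exact measure_mono_null hsub (volume_image_eq_zero_of_lipschitzOnWith
        ((lipschitzOnWith_flow hK hbc h).mono (sdiff_subset.trans hA)) hnull)
  have hder : ∀ u ∈ A ∩ D, HasFDerivWithinAt φ (fderiv ℝ φ u) (A ∩ D) u := fun u hu =>
    (show DifferentiableAt ℝ φ u from hu.2).hasFDerivAt.hasFDerivWithinAt
  have hinj : InjOn φ (A ∩ D) := (injOn_flow hK hbc h).mono (inter_subset_left.trans hA)
  have himg : φ '' (A ∩ D) ⊆ unitCube n := by
    rintro _ ⟨u, hu, rfl⟩
    exact flow_mem hK hbc (hA hu.1) h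
  constructor
  · rw [← integrableOn_congr_set_ae hae]
    simpa using (integrableOn_image_iff_integrableOn_abs_det_fderiv_smul volume (hAm.inter hD)
      hder hinj G).1 (integrableOn_unitCube hG himg)
  · rw [← setIntegral_congr_set haeimg, ← setIntegral_congr_set hae]
    simpa using integral_image_eq_integral_abs_det_fderiv_smul volume (hAm.inter hD) hder hinj G

/-- The Reynolds transport theorem for the flow, at time zero. -/
theorem hasDerivAt_integral_image_flow (hK : LipschitzWith K F)
    (hbc : SatisfiesBoundaryConditions F) (hF : ContDiff ℝ (⊤ : ℕ∞) F) {K₂ : NNReal}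
    (hK₂ : LipschitzWith K₂ fun u => fderiv ℝ F u (F u)) {G : (Fin n → ℝ) → ℝ}
    (hG : ContDiff ℝ (⊤ : ℕ∞) G) {A : Set (Fin n → ℝ)} (hAm : MeasurableSet A)
    (hA : A ⊆ unitCube n) :
    HasDerivAt (fun h => ∫ u in (fun u => flow F u h) '' A, G u)
      (∫ u in A, divergence (fun v => G v • F v) u) 0 := by
  have h0 : (fun u => flow F u 0) '' A = A := by
    rw [EqOn.image_eq (f₂ := id) fun u hu => (flow_spec hK hbc (hA hu)).2, image_id]
  rw [hasDerivAt_iff_isLittleO, Asymptotics.isLittleO_iff]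
  intro ε hε
  obtain ⟨η, hη, hest⟩ := exists_abs_transport_sub_le hK hbc hF hK₂ hG hε
  refine Metric.eventually_nhds_iff.2 ⟨η, hη, fun h hh => ?_⟩
  rw [dist_zero_right, Real.norm_eq_abs] at hh
  obtain ⟨hint, heq⟩ := integral_image_flow hK hbc hG.continuous hAm hA h
  have hGi := integrableOn_unitCube hG.continuous hA
  have hdi : IntegrableOn (divergence fun v => G v • F v) A :=
    integrableOn_unitCube (hG.smul hF).divergence.continuous hA
  have hvol : volume A ≤ 1 := (measure_mono hA).trans (volume_unitCube n).le
  have hvol' : volume.real A ≤ 1 := ENNReal.toReal_le_of_le_ofReal zero_le_one (by simpa using hvol)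
  rw [h0, sub_zero, heq, smul_eq_mul, ← integral_const_mul, ← integral_sub hint hGi,
    ← integral_sub (by exact hint.sub hGi) (hdi.const_mul h)]
  -- The pointwise expansion is uniform almost everywhere on `A`, whose volume is at most `1`, so
  -- the error integrates to at most `ε |h|`.
  have hbound := norm_setIntegral_le_of_norm_le_const_ae' (μ := volume) (s := A) (C := ε * |h|)
    (f := fun u => |(fderiv ℝ (fun v => flow F v h) u).det| * G (flow F u h) - G u -
      h * divergence (fun v => G v • F v) u) (hvol.trans_lt ENNReal.one_lt_top) (by
      filter_upwards [ae_differentiableAt_flow hK hbc h] with u hu hmem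
      exact hest h hh.le u (hA hmem) (hu (hA hmem)))
  refine hbound.trans ?_
  rw [Real.norm_eq_abs]
  exact mul_le_of_le_one_right (by positivity) hvol'

theorem controlMass_subset (R : Set (Fin n → ℝ)) (τ s : ℝ) : controlMass F R τ s ⊆ unitCube n :=
  fun _ hu => hu.1

theorem measurableSet_controlMass (hK : LipschitzWith K F) (hbc : SatisfiesBoundaryConditions F)
    {R : Set (Fin n → ℝ)} (hR : MeasurableSet R) (τ s : ℝ) :
    MeasurableSet (controlMass F R τ s) := by
  have hc : Continuous ((unitCube n).domRestrict fun u => flow F u (τ - s)) :=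
    (lipschitzOnWith_flow hK hbc (τ - s)).continuousOn.domRestrict
  have := (isOpen_unitCube n).measurableSet.subtype_image (hc.measurable hR)
  convert this using 1
  ext u
  simp [controlMass, domRestrict_apply, and_comm]

theorem image_flow_controlMass (hK : LipschitzWith K F) (hbc : SatisfiesBoundaryConditions F)
    (R : Set (Fin n → ℝ)) (τ s s' : ℝ) :
    (fun u => flow F u (s' - s)) '' controlMass F R τ s = controlMass F R τ s' := by
  ext u
  constructor
  · rintro ⟨v, hv, rfl⟩
    refine ⟨flow_mem hK hbc hv.1 _, ?_⟩
    rw [← flow_add hK hbc hv.1, show s' - s + (τ - s') = τ - s by ring]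
    exact hv.2
  · rintro ⟨hu, huR⟩
    refine ⟨flow F u (s - s'), ⟨flow_mem hK hbc hu _, ?_⟩, ?_⟩
    · rwa [← flow_add hK hbc hu, show s - s' + (τ - s) = τ - s' by ring]
    · change flow F (flow F u (s - s')) (s' - s) = u
      rw [← neg_sub s s', flow_neg_flow hK hbc hu]

/-- The Reynolds transport theorem for the control mass. -/
theorem hasDerivAt_integral_controlMass (hK : LipschitzWith K F)
    (hbc : SatisfiesBoundaryConditions F) (hF : ContDiff ℝ (⊤ : ℕ∞) F) {K₂ : NNReal}
    (hK₂ : LipschitzWith K₂ fun u => fderiv ℝ F u (F u)) {G : (Fin n → ℝ) → ℝ}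
    (hG : ContDiff ℝ (⊤ : ℕ∞) G) {R : Set (Fin n → ℝ)} (hR : MeasurableSet R) (τ s : ℝ) :
    HasDerivAt (fun s => ∫ u in controlMass F R τ s, G u)
      (∫ u in controlMass F R τ s, divergence (fun v => G v • F v) u) s := by
  have h1 := hasDerivAt_integral_image_flow hK hbc hF hK₂ hG
    (measurableSet_controlMass hK hbc hR τ s) (controlMass_subset R τ s)
  rw [← sub_self s] at h1
  simpa only [image_flow_controlMass hK hbc] using h1.comp_sub_const s s

/-- Each step is the transport theorem with density `Γ_j`; the recursion defining `Γ` is made for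
this. -/
theorem iteratedDeriv_volumeFunction (hK : LipschitzWith K F)
    (hbc : SatisfiesBoundaryConditions F) (hF : ContDiff ℝ (⊤ : ℕ∞) F) {K₂ : NNReal}
    (hK₂ : LipschitzWith K₂ fun u => fderiv ℝ F u (F u)) {R : Set (Fin n → ℝ)}
    (hR : MeasurableSet R) (τ : ℝ) (j : ℕ) :
    iteratedDeriv j (volumeFunction F R τ) = fun s => ∫ u in controlMass F R τ s, Gam F j u := by
  induction j with
  | zero =>
    ext s
    simp [Gam, volumeFunction, Measure.real]
  | succ j ih =>
    rw [iteratedDeriv_succ, ih]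
    ext s
    exact (hasDerivAt_integral_controlMass hK hbc hF hK₂ (hF.Gam j) hR τ s).deriv

theorem contDiff_volumeFunction (hK : LipschitzWith K F)
    (hbc : SatisfiesBoundaryConditions F) (hF : ContDiff ℝ (⊤ : ℕ∞) F) {K₂ : NNReal}
    (hK₂ : LipschitzWith K₂ fun u => fderiv ℝ F u (F u)) {R : Set (Fin n → ℝ)}
    (hR : MeasurableSet R) (τ : ℝ) : ContDiff ℝ (⊤ : ℕ∞) (volumeFunction F R τ) := by
  refine contDiff_of_differentiable_iteratedDeriv fun j _ => ?_
  rw [iteratedDeriv_volumeFunction hK hbc hF hK₂ hR]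
  exact fun s =>
    (hasDerivAt_integral_controlMass hK hbc hF hK₂ (hF.Gam j) hR τ s).differentiableAt

end Transport

/-! ### Taylor's theorem and the volume bounds. -/

theorem IsHyperrectangle.measurableSet {n : ℕ} {R : Set (Fin n → ℝ)} (hR : IsHyperrectangle R) :
    MeasurableSet R := by
  obtain ⟨I, hI, rfl⟩ := hR
  have : {u : Fin n → ℝ | ∀ i, u i ∈ I i} = univ.pi I := by ext u; simp
  rw [this]
  exact MeasurableSet.univ_pi fun i => (hI i).measurableSet

/-- Taylor's theorem with an upper bound on the remainder: if the derivative of order `k + 1`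
has sign-adjusted values at most `δ` times the function, the remainder at `s ≤ τ` is at most `δ`
times an intermediate value of the function. -/
theorem exists_le_taylor_add_of_iteratedDeriv_le {V : ℝ → ℝ} (hV : ContDiff ℝ (⊤ : ℕ∞) V)
    {k : ℕ} {δ τ s : ℝ} (hs : s < τ)
    (hδ : ∀ ξ ∈ Icc s τ, (-1) ^ (k + 1) * iteratedDeriv (k + 1) V ξ ≤ δ * V ξ) :
    ∃ ξ ∈ Icc s τ, V s ≤ (∑ j ∈ Finset.range (k + 1),
      iteratedDeriv j V τ * ((s - τ) ^ j / (j.factorial : ℝ))) +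
        δ * V ξ * ((τ - s) ^ (k + 1) / ((k + 1).factorial : ℝ)) := by
  obtain ⟨ξ, hξ, h⟩ := taylor_mean_remainder_lagrange_iteratedDeriv (f := V) (x := s) (x₀ := τ)
    (n := k) hs.ne' (hV.of_le (by exact_mod_cast le_top)).contDiffOn
  have hξ' : ξ ∈ Icc s τ := by
    rw [uIoo_of_gt hs] at hξ
    exact Ioo_subset_Icc_self hξ
  refine ⟨ξ, hξ', ?_⟩
  have htaylor : taylorWithinEval V k (uIcc τ s) τ s = ∑ j ∈ Finset.range (k + 1),
      iteratedDeriv j V τ * ((s - τ) ^ j / (j.factorial : ℝ)) := by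
    rw [taylor_within_apply]
    refine Finset.sum_congr rfl fun j _ => ?_
    rw [iteratedDerivWithin_eq_iteratedDeriv (uniqueDiffOn_uIcc hs.ne')
      (hV.contDiffAt.of_le (by exact_mod_cast le_top)) left_mem_uIcc, smul_eq_mul]
    ring
  rw [← htaylor, ← sub_le_iff_le_add', h]
  -- Expanding backwards from `τ` produces the sign `(-1)^(k+1)` that appears in the hypothesis on
  -- `δ`.
  have hpow : (s - τ) ^ (k + 1) = (-1) ^ (k + 1) * (τ - s) ^ (k + 1) := by
    rw [← mul_pow]; congr 1; ring
  have hnn : 0 ≤ (τ - s) ^ (k + 1) / ((k + 1).factorial : ℝ) :=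
    div_nonneg (pow_nonneg (by linarith) _) (by positivity)
  calc iteratedDeriv (k + 1) V ξ * (s - τ) ^ (k + 1) / ((k + 1).factorial : ℝ)
      = (-1) ^ (k + 1) * iteratedDeriv (k + 1) V ξ *
          ((τ - s) ^ (k + 1) / ((k + 1).factorial : ℝ)) := by rw [hpow]; ring
    _ ≤ _ := mul_le_mul_of_nonneg_right (hδ ξ hξ') hnn

theorem theorem3 (n : ℕ) (f : (Fin n → ℝ) → (Fin n → ℝ))
    (hbc : SatisfiesBoundaryConditions f) (hf : HasHolomorphicContinuation f)
    (R : Set (Fin n → ℝ)) (hR : IsHyperrectangle R) (hRU : R ⊆ unitCube n)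
    (t τ : ℝ) (ht : 0 ≤ t) (htτ : t < τ) (k : ℕ)
    -- the tube region, any set that contains every control mass at times between `t` and `τ`
    (T : Set (Fin n → ℝ)) (hT : ∀ s ∈ Set.Icc t τ, controlMass f R τ s ⊆ T)
    (δ : ℝ) (hδT : ∀ u ∈ T, (-1) ^ (k + 1) * Gam f (k + 1) u ≤ δ)
    (κ : ℝ) (hκ : ∀ ξ ∈ Set.Icc t τ, taylorVolume f R k τ ξ ≤ κ)
    (hδ0 : 0 ≤ δ) (hδ1 : δ < ((k + 1).factorial : ℝ) / |t - τ| ^ (k + 1)) :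
    sSup (volumeFunction f R τ '' Set.Icc t τ) ≤
        κ * (1 - δ * (|t - τ| ^ (k + 1) / ((k + 1).factorial : ℝ)))⁻¹ ∧
      volumeFunction f R τ t ≤ taylorVolume f R k τ t +
        κ * δ * (((k + 1).factorial : ℝ) / |t - τ| ^ (k + 1) - δ)⁻¹ := by
  obtain ⟨F, hF, hFc, hFf⟩ := hf.exists_contDiff
  have hcube : EqOn f F (unitCube n) := fun u hu =>
    (hFf u fun i => ⟨(hu i).1.le, (hu i).2.le⟩).symm
  have hbcF : SatisfiesBoundaryConditions F := fun u hu i hi => by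
    rw [hFf u hu]
    exact hbc u hu i hi
  obtain ⟨K, hK⟩ := hF.lipschitzWith_of_hasCompactSupport hFc (by simp)
  have hHs : ContDiff ℝ (⊤ : ℕ∞) fun u => fderiv ℝ F u (F u) :=
    (hF.fderiv_right (m := (⊤ : ℕ∞)) (by simp)).clm_apply hF
  have hHc : HasCompactSupport fun u => fderiv ℝ F u (F u) :=
    hFc.mono fun u hu hFu => hu (by simp [show F u = 0 from hFu])
  obtain ⟨K₂, hK₂⟩ := hHs.lipschitzWith_of_hasCompactSupport hHc (by simp)
  have hRm := hR.measurableSet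
  rw [controlMass_congr hcube] at hT
  rw [taylorVolume_congr hcube] at hκ
  rw [volumeFunction_congr hcube, taylorVolume_congr hcube]
  set V := volumeFunction F R τ with hV
  have hVs : ContDiff ℝ (⊤ : ℕ∞) V := contDiff_volumeFunction hK hbcF hF hK₂ hRm τ
  -- The pointwise bound on `Γ_{k+1}` is integrated over the control mass, which lies in `T`; the
  -- constant `δ` then contributes `δ V`.
  have hVδ : ∀ ξ ∈ Icc t τ, (-1) ^ (k + 1) * iteratedDeriv (k + 1) V ξ ≤ δ * V ξ := by
    intro ξ hξ
    have hsub := controlMass_subset (F := F) R τ ξ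
    rw [iteratedDeriv_volumeFunction hK hbcF hF hK₂ hRm, ← integral_const_mul]
    have hfin : volume (controlMass F R τ ξ) ≠ ⊤ :=
      ((measure_mono hsub).trans_lt (by simp [volume_unitCube])).ne
    have := setIntegral_mono_on (μ := volume)
      ((integrableOn_unitCube (hF.Gam (k + 1)).continuous hsub).const_mul ((-1) ^ (k + 1)))
      (integrableOn_const hfin (C := δ)) (measurableSet_controlMass hK hbcF hRm τ ξ)
      (fun u hu => by
        rw [← eqOn_Gam_of_eqOn hcube (k + 1) (hsub hu)]
        exact hδT u (hT ξ hξ hu))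
    refine this.trans (le_of_eq ?_)
    rw [setIntegral_const, smul_eq_mul, mul_comm]
    rfl
  set c : ℝ := (τ - t) ^ (k + 1) / ((k + 1).factorial : ℝ) with hc
  have habs : |t - τ| = τ - t := by rw [abs_sub_comm, abs_of_pos (sub_pos.2 htτ)]
  have hpow : 0 < (τ - t) ^ (k + 1) := pow_pos (sub_pos.2 htτ) _
  have hfac : (0 : ℝ) < ((k + 1).factorial : ℝ) := by positivity
  have hc0 : 0 < c := div_pos hpow hfac
  have hcinv : ((k + 1).factorial : ℝ) / (τ - t) ^ (k + 1) = c⁻¹ := by rw [hc, inv_div]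
  rw [habs, hcinv] at hδ1 ⊢
  have hδc : δ * c < 1 := by rwa [← one_div, lt_div_iff₀ hc0] at hδ1
  set M := sSup (V '' Icc t τ) with hM
  have hbdd : BddAbove (V '' Icc t τ) := (isCompact_Icc.image hVs.continuous).bddAbove
  have hVM : ∀ ξ ∈ Icc t τ, V ξ ≤ M := fun ξ hξ => le_csSup hbdd (mem_image_of_mem V hξ)
  have hM0 : 0 ≤ M := ENNReal.toReal_nonneg.trans (hVM t ⟨le_rfl, htτ.le⟩)
  -- The remainder is bounded uniformly in `s` by using the full length `τ - t` in `c` and the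
  -- supremum `M`, so that the supremum over `s` can be taken afterwards.
  have hstep : ∀ s ∈ Icc t τ, V s ≤ taylorVolume F R k τ s + δ * M * c := by
    intro s hs
    -- Lagrange's remainder needs `s < τ`; at `s = τ` the Taylor polynomial is `V τ` itself.
    rcases hs.2.eq_or_lt with rfl | hsτ
    · have : taylorVolume F R k s s = V s := by
        rw [taylorVolume, Finset.sum_eq_single 0]
        · simp [hV]
        · intro j _ hj
          simp [hj]
        · simp
      rw [this]
      have : 0 ≤ δ * M * c := by positivity
      linarith
    · obtain ⟨ξ, hξ, h⟩ := exists_le_taylor_add_of_iteratedDeriv_le hVs hsτ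
        fun ξ hξ => hVδ ξ ⟨hs.1.trans hξ.1, hξ.2⟩
      refine h.trans (add_le_add le_rfl ?_)
      have hsτ' : 0 ≤ τ - s := by linarith
      have h1 : (τ - s) ^ (k + 1) / ((k + 1).factorial : ℝ) ≤ c := by
        rw [hc]
        gcongr
        exact hs.1
      have h2 := hVM ξ ⟨hs.1.trans hξ.1, hξ.2⟩
      gcongr
  -- From `M ≤ κ + δ c M` the term in `M` is absorbed on the left, which is possible because `M` is
  -- finite and `δ c < 1`.
  have hMle : M ≤ κ * (1 - δ * c)⁻¹ := by
    rw [← div_eq_mul_inv, le_div_iff₀ (by linarith)]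
    have : M ≤ κ + δ * M * c := by
      refine csSup_le ((nonempty_Icc.2 htτ.le).image V) ?_
      rintro _ ⟨s, hs, rfl⟩
      exact (hstep s hs).trans (by linarith [hκ s hs])
    linarith
  refine ⟨hMle, (hstep t ⟨le_rfl, htτ.le⟩).trans (add_le_add le_rfl ?_)⟩
  have hne : 1 - δ * c ≠ 0 := by linarith
  calc δ * M * c ≤ δ * (κ * (1 - δ * c)⁻¹) * c := by gcongr
    _ = κ * δ * (c⁻¹ - δ)⁻¹ := by
      have : c⁻¹ - δ = (1 - δ * c) * c⁻¹ := by field_simp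
      rw [this, mul_inv, inv_inv]
      ring
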